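/- Let $M$ be a compact connected smooth manifold (without boundary), let $\pi\colon X\to M$ be a smooth principal $S^1$-bundle with action $r_\theta\colon X\to X$, and let $Z=\partial/\partial\theta$ be the generator of the action. Let $G=N^2\,\alpha\otimes\alpha+\pi^*g$ be a bundle (Kaluza–Klein) metric on $X$, where $g$ is a Riemannian metric on $M$, $\alpha$ is a connection $1$-form (a smooth $S^1$-invariant $1$-form with $\alpha(Z)=1$), and $N>0$ is a constant. Let $m\in\mathbb Z\setminus\{0\}$ and let $\phi\colon X\to\mathbb C$ be an equivariant eigenfunction of weight $m$, that is, a smooth function, not identically zero, with $$\phi(r_\theta x)=e^{im\theta}\phi(x)\quad\text{for all }\theta,\,x,\qquad \Delta_G\phi=-\lambda^2\phi\quad\text{for some }\lambda\in\mathbb R,$$ where $\Delta_G$ is the Laplace–Beltrami operator of $G$. Let $L^m\to M$ be the complex line bundle associated with $X$, obtained from $X\times\mathbb C$ by identifying $(x,w)$ with $(r_\theta x,e^{im\theta}w)$, and let $s$ be the section of $L^m$ corresponding to $\phi$, given by $s(\pi(x))=[x,\phi(x)]$. Suppose that $0\in\mathbb C$ is a regular value of $\phi\colon X\to\mathbb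 C$ and that $s(z_0)=0$ for some $z_0\in M$. Then the nodal set $\mathcal N=\{x\in X:\operatorname{Re}\phi(x)=0\}$ is a connected smooth embedded hypersurface of $X$, and its complement $X\setminus\mathcal N$ has exactly two connected components. -/

import Mathlib

open Set Bundle
open scoped Manifold ContDiff Topology

noncomputable section

namespace CircleBundle

/-! ### Laplacian of a Riemannian metric -/

section Laplacian

variable {d : ℕ} {X : Type*} [TopologicalSpace X] [ChartedSpace (EuclideanSpace ℝ (Fin d)) X]
  [IsManifold (𝓡 d) ∞ X]

/-- Smooth Riemannian metrics on a `d`-dimensional manifold. -/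
abbrev RMetric (d : ℕ) (X : Type*) [TopologicalSpace X]
    [ChartedSpace (EuclideanSpace ℝ (Fin d)) X] [IsManifold (𝓡 d) ∞ X] :=
  ContMDiffRiemannianMetric (𝓡 d) ∞ (EuclideanSpace ℝ (Fin d))
    (fun x : X ↦ TangentSpace (𝓡 d) x)

/-- The `i`-th coordinate vector. -/
def coordVec (i : Fin d) : EuclideanSpace ℝ (Fin d) := EuclideanSpace.single i 1

/-- The matrix `G_{ij}` of the metric in the preferred chart at `x`, as a function of the
coordinates `y` in the target of that chart. -/
def gram (G : RMetric d X) (x : X) (y : EuclideanSpace ℝ (Fin d)) : Matrix (Fin d) (Fin d) ℝ :=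
  Matrix.of fun i j ↦ G.inner ((extChartAt (𝓡 d) x).symm y)
    (mfderiv (𝓡 d) (𝓡 d) (extChartAt (𝓡 d) x).symm y (coordVec i))
    (mfderiv (𝓡 d) (𝓡 d) (extChartAt (𝓡 d) x).symm y (coordVec j))

/-- The Laplace-Beltrami operator `Δ_G` (with the analysts' sign) on complex functions:
`Δ_G f = |G|^{-1/2} ∑ᵢ ∂ᵢ (∑ⱼ |G|^{1/2} G^{ij} ∂ⱼ f)` in coordinates. -/
def laplacian (G : RMetric d X) (f : X → ℂ) (x : X) : ℂ :=
  (Real.sqrt (gram G x (extChartAt (𝓡 d) x x)).det)⁻¹ •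
    ∑ i, fderiv ℝ (fun y ↦ ∑ j, (Real.sqrt (gram G x y).det * (gram G x y)⁻¹ i j) •
        fderiv ℝ (f ∘ (extChartAt (𝓡 d) x).symm) y (coordVec j))
      (extChartAt (𝓡 d) x x) (coordVec i)

end Laplacian

/-! ### Embedded hypersurfaces and regular values -/

section Hypersurface

/-- `S` is a smooth embedded hypersurface of the `(n+1)`-dimensional manifold `X`: near each of its
points there is a smooth chart of `X` in which `S` is the slice where the last coordinate
vanishes. -/
def IsEmbeddedHypersurface (n : ℕ) {X : Type*} [TopologicalSpace X]
    [ChartedSpace (EuclideanSpace ℝ (Fin (n + 1))) X] (S : Set X) : Prop :=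
  ∀ x ∈ S, ∃ e ∈ IsManifold.maximalAtlas (𝓡 (n + 1)) ∞ X, x ∈ e.source ∧
    ∀ p ∈ e.source, p ∈ S ↔ e p (Fin.last n) = 0

/-- `0 ∈ ℂ` is a regular value of `φ : X → ℂ`. -/
def ZeroIsRegularValue (d : ℕ) {X : Type*} [TopologicalSpace X]
    [ChartedSpace (EuclideanSpace ℝ (Fin d)) X] (φ : X → ℂ) : Prop :=
  ∀ x, φ x = 0 → Function.Surjective (mfderiv (𝓡 d) 𝓘(ℝ, ℂ) φ x)

/-- The nodal set of the real part of `φ`. -/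
def nodalSet {X : Type*} (φ : X → ℂ) : Set X := {x | (φ x).re = 0}

end Hypersurface

/-! ### Principal circle bundles, connections, bundle metrics -/

section Bundle

variable {n : ℕ}
  {M : Type*} [TopologicalSpace M] [ChartedSpace (EuclideanSpace ℝ (Fin n)) M]
  {X : Type*} [TopologicalSpace X] [ChartedSpace (EuclideanSpace ℝ (Fin (n + 1))) X]
  [MulAction Circle X]

/-- `pr : X → M` with the given action of the circle on `X` is a smooth principal circle bundle over
the `n`-dimensional manifold `M`. -/
structure IsPrincipal (n : ℕ)
    {M : Type*} [TopologicalSpace M] [ChartedSpace (EuclideanSpace ℝ (Fin n)) M]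
    {X : Type*} [TopologicalSpace X] [ChartedSpace (EuclideanSpace ℝ (Fin (n + 1))) X]
    [MulAction Circle X] (pr : X → M) : Prop where
  smooth_action : ContMDiff ((𝓡 1).prod (𝓡 (n + 1))) (𝓡 (n + 1)) ∞
    (fun p : Circle × X ↦ p.1 • p.2)
  smooth_proj : ContMDiff (𝓡 (n + 1)) (𝓡 n) ∞ pr
  proj_smul : ∀ (a : Circle) (x : X), pr (a • x) = pr x
  locally_trivial : ∀ z : M, ∃ e : Trivialization Circle pr, z ∈ e.baseSet ∧
    ContMDiffOn (𝓡 (n + 1)) ((𝓡 n).prod (𝓡 1)) ∞ e e.source ∧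
    ContMDiffOn ((𝓡 n).prod (𝓡 1)) (𝓡 (n + 1)) ∞ e.toOpenPartialHomeomorph.symm e.target ∧
    ∀ (a : Circle), ∀ x ∈ e.source, (e (a • x)).2 = a * (e x).2

/-- The generator `Z = ∂/∂θ` of the circle action. -/
def generator (n : ℕ) {X : Type*} [TopologicalSpace X]
    [ChartedSpace (EuclideanSpace ℝ (Fin (n + 1))) X] [MulAction Circle X] (x : X) :
    TangentSpace (𝓡 (n + 1)) x :=
  mfderiv 𝓘(ℝ, ℝ) (𝓡 (n + 1)) (fun θ : ℝ ↦ Circle.exp θ • x) 0 (1 : ℝ)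

/-- `α` is a connection 1-form: a smooth circle-invariant 1-form on `X` with `α(Z) = 1`. -/
structure IsConnectionForm [IsManifold (𝓡 (n + 1)) ∞ X]
    (α : ∀ x : X, TangentSpace (𝓡 (n + 1)) x →L[ℝ] ℝ) : Prop where
  smooth : ContMDiff (𝓡 (n + 1))
    ((𝓡 (n + 1)).prod 𝓘(ℝ, EuclideanSpace ℝ (Fin (n + 1)) →L[ℝ] ℝ)) ∞
    (fun x ↦ TotalSpace.mk' (EuclideanSpace ℝ (Fin (n + 1)) →L[ℝ] ℝ) x (α x))
  invariant : ∀ (a : Circle) (x : X) (v : TangentSpace (𝓡 (n + 1)) x),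
    α (a • x) (mfderiv (𝓡 (n + 1)) (𝓡 (n + 1)) (fun y : X ↦ a • y) x v) = α x v
  apply_generator : ∀ x, α x (generator n x) = 1

/-- `G` is the bundle (Kaluza-Klein) metric `N² α ⊗ α + pr^* g`. -/
def IsBundleMetric [IsManifold (𝓡 n) ∞ M] [IsManifold (𝓡 (n + 1)) ∞ X] (pr : X → M)
    (N : ℝ) (α : ∀ x : X, TangentSpace (𝓡 (n + 1)) x →L[ℝ] ℝ) (g : RMetric n M)
    (G : RMetric (n + 1) X) : Prop :=
  ∀ (x : X) (v w : TangentSpace (𝓡 (n + 1)) x), G.inner x v w = N ^ 2 * (α x v * α x w) +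
    g.inner (pr x) (mfderiv (𝓡 (n + 1)) (𝓡 n) pr x v) (mfderiv (𝓡 (n + 1)) (𝓡 n) pr x w)

/-- `φ` is an equivariant eigenfunction of weight `m` of `Δ_G`: a smooth, not identically zero
function with `φ(r_θ x) = e^{imθ} φ(x)` and `Δ_G φ = -λ² φ` for some real `λ`. -/
structure IsEquivariantEigenfunction [IsManifold (𝓡 (n + 1)) ∞ X] (G : RMetric (n + 1) X)
    (m : ℤ) (φ : X → ℂ) : Prop where
  smooth : ContMDiff (𝓡 (n + 1)) 𝓘(ℝ, ℂ) ∞ φ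
  ne_zero : φ ≠ 0
  equivariant : ∀ (a : Circle) (x : X), φ (a • x) = (a : ℂ) ^ m * φ x
  eigen : ∃ l : ℝ, ∀ x, laplacian G φ x = -((l : ℂ) ^ 2) * φ x

theorem IsPrincipal.surjective {pr : X → M} (h : IsPrincipal n pr) : Function.Surjective pr := by
  intro z
  obtain ⟨e, hz, -⟩ := h.locally_trivial z
  exact ⟨e.toOpenPartialHomeomorph.symm (z, 1), e.proj_symm_apply' hz⟩

theorem IsPrincipal.exists_smul_eq {pr : X → M} (h : IsPrincipal n pr) {x y : X}
    (hxy : pr x = pr y) : ∃ a : Circle, a • x = y := by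
  obtain ⟨e, hz, -, -, he⟩ := h.locally_trivial (pr y)
  have hy : y ∈ e.source := e.mem_source.2 hz
  have hx : x ∈ e.source := e.mem_source.2 (hxy ▸ hz)
  refine ⟨(e y).2 * ((e x).2)⁻¹, ?_⟩
  have hax : ((e y).2 * ((e x).2)⁻¹) • x ∈ e.source :=
    e.mem_source.2 (by rw [h.proj_smul]; exact e.mem_source.1 hx)
  apply e.injOn hax hy
  refine Prod.ext ?_ ?_
  · exact (e.coe_fst hax).trans ((h.proj_smul _ _).trans (hxy.trans (e.coe_fst hy).symm))
  · exact (he _ _ hx).trans (by simp)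

end Bundle

/-! ### The associated line bundles `L^m` -/

section LineBundle

/-- The relation `(x, w) ~ (a x, a^m w)` on `X × ℂ`. -/
def lineSetoid (X : Type*) [MulAction Circle X] (m : ℤ) : Setoid (X × ℂ) where
  r p q := ∃ a : Circle, a • p.1 = q.1 ∧ (a : ℂ) ^ m * p.2 = q.2
  iseqv :=
    { refl := fun p ↦ ⟨1, by simp⟩
      symm := by
        rintro p q ⟨a, h1, h2⟩
        refine ⟨a⁻¹, by rw [← h1, inv_smul_smul], ?_⟩
        rw [← h2, ← mul_assoc, Circle.coe_inv, ← mul_zpow, inv_mul_cancel₀ a.coe_ne_zero,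
          one_zpow, one_mul]
      trans := by
        rintro p q r ⟨a, h1, h2⟩ ⟨b, h3, h4⟩
        refine ⟨b * a, by rw [mul_smul, h1, h3], ?_⟩
        rw [← h4, ← h2, ← mul_assoc, Circle.coe_mul, mul_zpow] }

/-- The total space of `L^m`, the complex line bundle associated with the principal bundle `X` and
the `m`-th character. The convention is the one in which `X` is the unit circle bundle of the dual
of `L` and `[x, w]` is the vector `v` of `L^m` with `x^{⊗ m}(v) = w`, so that functions of weight `m`
on `X` are sections of `L^m`. -/
def LineBundle (X : Type*) [MulAction Circle X] (m : ℤ) : Type _ := Quotient (lineSetoid X m)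

/-- The vector `[x, w]` of `L^m`. -/
def LineBundle.mk {X : Type*} [MulAction Circle X] (m : ℤ) (x : X) (w : ℂ) : LineBundle X m :=
  Quotient.mk (lineSetoid X m) (x, w)

variable {n : ℕ}
  {M : Type*} [TopologicalSpace M] [ChartedSpace (EuclideanSpace ℝ (Fin n)) M]
  {X : Type*} [TopologicalSpace X] [ChartedSpace (EuclideanSpace ℝ (Fin (n + 1))) X]
  [MulAction Circle X] {pr : X → M}

/-- The section `pr x ↦ [x, φ x]` of `L^m` associated with a function `φ` of weight `m`; by
`assocSection_proj` it does not depend on the choice of `x` in the fibre. -/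
def assocSection (h : IsPrincipal n pr) (m : ℤ) (φ : X → ℂ) (z : M) : LineBundle X m :=
  LineBundle.mk m (Function.surjInv h.surjective z) (φ (Function.surjInv h.surjective z))

theorem assocSection_proj (h : IsPrincipal n pr) (m : ℤ) (φ : X → ℂ)
    (hφ : ∀ (a : Circle) (x : X), φ (a • x) = (a : ℂ) ^ m * φ x) (x : X) :
    assocSection h m φ (pr x) = LineBundle.mk m x (φ x) := by
  obtain ⟨a, ha⟩ := h.exists_smul_eq (Function.surjInv_eq h.surjective (pr x))
  refine Quotient.sound ⟨a, ha, ?_⟩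
  simp only
  rw [← hφ, ha]

/-- The zero section of `L^m`. -/
def zeroLineSection (h : IsPrincipal n pr) (m : ℤ) : M → LineBundle X m :=
  assocSection h m (fun _ ↦ 0)

end LineBundle

end CircleBundle

end

open CircleBundle

/-!
Let `D ⊆ ℂ` be a convex cone containing a nonzero vector and `P = φ⁻¹(D)`. The saturation under
the circle of the closure of a component of `P` is all of `X`. It is closed since the circle is
compact. It is open away from the zeros of `φ`, because there the action can be used to rotate
`φ` to a locally constant phase, and it is open at a zero, because there `φ` is a submersion and
`P` is locally connected up to that point; the circle being connected, a component of `P` that is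
adherent to one point of an orbit of zeros is adherent to the whole orbit. Hence every component
of `P` is adherent to every zero of `φ`, near which `P` has a single piece, so `P` is connected as
soon as `φ` has a zero. The cones `Re w = 0`, `Re w > 0` and `Re w < 0` give the nodal set and the
two sides of it.

The nodal set is a hypersurface because `Re φ` is a submersion along it: at the zeros of `φ` by
assumption, elsewhere because `dφ(Z) = i m φ` is real and nonzero.
-/

namespace CircleBundle

section RelativeComponents

variable {X : Type*} [TopologicalSpace X] {P S U : Set X} {p x : X}

theorem connectedComponentIn_mem_nhdsWithin (hU : U ∈ 𝓝 x) (hUP : IsPreconnected (P ∩ U))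
    (hx : x ∈ closure (connectedComponentIn P p)) : connectedComponentIn P p ∈ 𝓝[P] x := by
  obtain ⟨y, hyU, hyC⟩ := mem_closure_iff_nhds.1 hx U hU
  have hyP : y ∈ P := connectedComponentIn_subset P p hyC
  rw [connectedComponentIn_eq hyC]
  exact Filter.mem_of_superset (inter_mem_nhdsWithin P hU)
    (hUP.subset_connectedComponentIn ⟨hyP, hyU⟩ inter_subset_left)

theorem eventually_mem_closure_of_mem_nhdsWithin (hS : S ∈ 𝓝[P] x) :
    ∀ᶠ y in 𝓝 x, y ∈ closure P → y ∈ closure S := by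
  filter_upwards [eventually_nhds_nhdsWithin.2 hS] with y hy hyP
  rw [mem_closure_iff_nhdsWithin_neBot] at hyP ⊢
  exact hyP.mono (nhdsWithin_le_iff.2 hy)

end RelativeComponents

section CompactGroupAction

open scoped Pointwise

variable {G X : Type*} [TopologicalSpace G] [Group G] [TopologicalSpace X]
  [MulAction G X] [ContinuousSMul G X] {P Z S : Set X} {p x z : X}

theorem connectedComponentIn_mem_nhdsWithin_smul [PreconnectedSpace G]
    (hZ : ∀ (a : G), ∀ z ∈ Z, a • z ∈ Z) (hZP : Z ⊆ closure P)
    (hloc : ∀ z ∈ Z, ∃ U ∈ 𝓝 z, IsPreconnected (P ∩ U)) (hz : z ∈ Z)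
    (hzp : z ∈ closure (connectedComponentIn P p)) (a : G) :
    connectedComponentIn P p ∈ 𝓝[P] (a • z) := by
  set C := connectedComponentIn P p
  have hnhds {b : G} (hb : b • z ∈ closure C) : C ∈ 𝓝[P] (b • z) :=
    have ⟨_, hU, hUP⟩ := hloc _ (hZ b z hz)
    connectedComponentIn_mem_nhdsWithin hU hUP hb
  have hcont : Continuous fun b : G ↦ b • z := by fun_prop
  have hclopen : IsClopen {b : G | b • z ∈ closure C} := by
    refine ⟨isClosed_closure.preimage hcont, isOpen_iff_eventually.2 fun b hb ↦ ?_⟩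
    filter_upwards [hcont.continuousAt.eventually
      (eventually_mem_closure_of_mem_nhdsWithin (hnhds hb))] with c hc
    exact hc (hZP (hZ c z hz))
  exact hnhds (eq_univ_iff_forall.1 (hclopen.eq_univ ⟨1, by simpa using hzp⟩) a)

theorem univ_smul_closure_mem_nhds [CompactSpace G] (hP : ∀ y, ∃ a : G, a • y ∈ closure P)
    (hS : ∀ a : G, S ∈ 𝓝[P] (a • x)) : (univ : Set G) • closure S ∈ 𝓝 x := by
  have hev : ∀ᶠ y in 𝓝 x, ∀ a ∈ (univ : Set G), a • y ∈ closure P → a • y ∈ closure S := by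
    refine isCompact_univ.eventually_forall_of_forall_eventually fun a _ ↦ ?_
    have hcont : ContinuousAt (fun w : X × G ↦ w.2 • w.1) (x, a) := by fun_prop
    exact hcont.eventually (eventually_mem_closure_of_mem_nhdsWithin (hS a))
  filter_upwards [hev] with y hy
  obtain ⟨a, ha⟩ := hP y
  exact ⟨a⁻¹, mem_univ _, a • y, hy a (mem_univ a) ha, inv_smul_smul a y⟩

theorem univ_smul_closure_connectedComponentIn [CompactSpace G] [PreconnectedSpace G]
    [ContinuousInv G] [PreconnectedSpace X]
    (hZ : ∀ (a : G), ∀ z ∈ Z, a • z ∈ Z) (hZP : Z ⊆ closure P)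
    (hloc : ∀ z ∈ Z, ∃ U ∈ 𝓝 z, IsPreconnected (P ∩ U)) (hP : ∀ x, ∃ a : G, a • x ∈ closure P)
    (hcov : ∀ x ∉ Z, ∃ U ∈ 𝓝 x, ∀ q ∈ P ∩ U, U ⊆ (univ : Set G) • connectedComponentIn P q)
    (hp : p ∈ P) : (univ : Set G) • closure (connectedComponentIn P p) = univ := by
  set C := connectedComponentIn P p
  have hnhds {y : X} (hy : y ∈ closure C) : (univ : Set G) • closure C ∈ 𝓝 y := by
    by_cases hyZ : y ∈ Z
    · exact univ_smul_closure_mem_nhds hP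
        (connectedComponentIn_mem_nhdsWithin_smul hZ hZP hloc hyZ hy)
    · obtain ⟨U, hU, hUC⟩ := hcov y hyZ
      obtain ⟨q, hqU, hqC⟩ := mem_closure_iff_nhds.1 hy U hU
      have hsub := hUC q ⟨connectedComponentIn_subset P p hqC, hqU⟩
      rw [← connectedComponentIn_eq hqC] at hsub
      exact Filter.mem_of_superset hU (hsub.trans (smul_subset_smul_left subset_closure))
  have hopen : IsOpen ((univ : Set G) • closure C) := by
    refine isOpen_iff_mem_nhds.2 ?_
    rintro _ ⟨a, -, y, hy, rfl⟩
    have hay := smul_mem_nhds_smul a (hnhds hy)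
    rwa [← smul_assoc, smul_set_univ] at hay
  have hclosed : IsClosed ((univ : Set G) • closure C) :=
    isClosed_closure.smul_left_of_isCompact isCompact_univ
  exact IsClopen.eq_univ ⟨hclosed, hopen⟩
    ⟨1 • p, smul_mem_smul (mem_univ 1) (subset_closure (mem_connectedComponentIn hp))⟩

theorem isConnected_of_invariant_adherent [CompactSpace G] [PreconnectedSpace G]
    [ContinuousInv G] [PreconnectedSpace X]
    (hZ : ∀ (a : G), ∀ z ∈ Z, a • z ∈ Z) (hZP : Z ⊆ closure P)
    (hloc : ∀ z ∈ Z, ∃ U ∈ 𝓝 z, IsPreconnected (P ∩ U)) (hP : ∀ x, ∃ a : G, a • x ∈ closure P)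
    (hcov : ∀ x ∉ Z, ∃ U ∈ 𝓝 x, ∀ q ∈ P ∩ U, U ⊆ (univ : Set G) • connectedComponentIn P q)
    (hne : Z.Nonempty) : IsConnected P := by
  obtain ⟨z, hz⟩ := hne
  have hzP : (𝓝[P] z).NeBot := mem_closure_iff_nhdsWithin_neBot.1 (hZP hz)
  have hnhds {p : X} (hp : p ∈ P) : connectedComponentIn P p ∈ 𝓝[P] z := by
    obtain ⟨a, -, y, hy, rfl⟩ : z ∈ (univ : Set G) • closure (connectedComponentIn P p) :=
      univ_smul_closure_connectedComponentIn hZ hZP hloc hP hcov hp ▸ mem_univ z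
    have hyZ : y ∈ Z := inv_smul_smul a y ▸ hZ a⁻¹ _ hz
    exact connectedComponentIn_mem_nhdsWithin_smul hZ hZP hloc hyZ hy a
  refine ⟨closure_nonempty_iff.1 ⟨z, hZP hz⟩, isPreconnected_of_forall_pair fun p hp q hq ↦ ?_⟩
  obtain ⟨y, hyp, hyq⟩ := Filter.nonempty_of_mem (Filter.inter_mem (hnhds hp) (hnhds hq))
  refine ⟨connectedComponentIn P p, connectedComponentIn_subset P p, mem_connectedComponentIn hp,
    ?_, isPreconnected_connectedComponentIn⟩
  rw [connectedComponentIn_eq hyp, ← connectedComponentIn_eq hyq]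
  exact mem_connectedComponentIn hq

end CompactGroupAction

section WeightedFunctions

open scoped Pointwise

/-- `φ` has weight `m` for an action of the circle: `φ (e^{iθ} x) = e^{imθ} φ x`. Such functions are
the sections of the `m`-th power of the associated line bundle. -/
def HasWeight {X : Type*} [SMul Circle X] (m : ℤ) (φ : X → ℂ) : Prop :=
  ∀ (a : Circle) (x : X), φ (a • x) = (a : ℂ) ^ m * φ x

theorem exp_neg_arg_div_zpow_mul {m : ℤ} (hm : m ≠ 0) (w : ℂ) :
    (Circle.exp (-w.arg / m) : ℂ) ^ m * w = ‖w‖ := by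
  have hexp : (Circle.exp (-w.arg / m) : ℂ) ^ m = Complex.exp (-(w.arg * Complex.I)) := by
    rw [Circle.coe_exp, ← Complex.exp_int_mul]
    congr 1
    push_cast
    field_simp
  conv_lhs => rw [hexp, ← Complex.norm_mul_exp_arg_mul_I w]
  rw [mul_left_comm, Complex.norm_mul_exp_arg_mul_I, ← Complex.exp_add, neg_add_cancel,
    Complex.exp_zero, mul_one]

variable {X : Type*} {m : ℤ} {φ : X → ℂ} {x : X}

theorem HasWeight.smul_eq_zero_iff [SMul Circle X] (hφ : HasWeight m φ) (a : Circle) :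
    φ (a • x) = 0 ↔ φ x = 0 := by
  rw [hφ, mul_eq_zero, or_iff_right (zpow_ne_zero m a.coe_ne_zero)]

theorem HasWeight.exp_smul_eq_norm_div_smul [SMul Circle X] (hφ : HasWeight m φ) (hm : m ≠ 0)
    {w : ℂ} (hw : w ≠ 0) (x : X) :
    φ (Circle.exp (-(φ x / w).arg / m) • x) = ‖φ x / w‖ • w := by
  rw [Complex.real_smul, ← exp_neg_arg_div_zpow_mul hm (φ x / w), hφ, mul_assoc,
    div_mul_cancel₀ _ hw]

theorem HasWeight.hasDerivAt_exp_smul [SMul Circle X] (hφ : HasWeight m φ) (x : X) :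
    HasDerivAt (fun θ : ℝ ↦ φ (Circle.exp θ • x)) (m * Complex.I * φ x) 0 := by
  have hexp : (fun θ : ℝ ↦ φ (Circle.exp θ • x)) =
      fun θ : ℝ ↦ Complex.exp (m * Complex.I * θ) * φ x := by
    ext θ
    rw [hφ, Circle.coe_exp, ← Complex.exp_int_mul]
    ring_nf
  have hlin : HasDerivAt (fun θ : ℝ ↦ m * Complex.I * (θ : ℂ)) (m * Complex.I) 0 := by
    simpa using (Complex.ofRealCLM.hasDerivAt (x := (0 : ℝ))).const_mul (m * Complex.I)
  rw [hexp]
  simpa using hlin.cexp.mul_const (φ x)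

variable [TopologicalSpace X]

theorem mem_closure_preimage_convexCone {E : Type*} [AddCommGroup E] [Module ℝ E]
    [TopologicalSpace E] [ContinuousSMul ℝ E] {f : X → E} (D : ConvexCone ℝ E) {w : E} (hw : w ∈ D)
    (hx : f x = 0) (hopen : 𝓝 (f x) ≤ (𝓝 x).map f) : x ∈ closure (f ⁻¹' D) := by
  have hlim : Filter.Tendsto (fun r : ℝ ↦ r • w) (𝓝[>] 0) (𝓝 (f x)) := by
    have hcont : Continuous fun r : ℝ ↦ r • w := by fun_prop
    simpa only [hx, zero_smul] using (hcont.tendsto 0).mono_left nhdsWithin_le_nhds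
  refine mem_closure_iff_nhds.2 fun U hU ↦ ?_
  obtain ⟨r, ⟨y, hyU, hy⟩, hr⟩ := ((hlim.eventually_mem
    (hopen (Filter.image_mem_map hU))).and self_mem_nhdsWithin).exists
  exact ⟨y, hyU, mem_preimage.2 (hy ▸ D.smul_mem hr hw)⟩

theorem exists_isPreconnected_div_mem_slitPlane [LocallyConnectedSpace X] (hφc : Continuous φ)
    (hx : φ x ≠ 0) : ∃ U ∈ 𝓝 x, IsPreconnected U ∧
      ∀ y ∈ U, ∀ z ∈ U, φ y / φ z ∈ Complex.slitPlane := by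
  have hcont : ContinuousAt (fun w : X × X ↦ φ w.1 / φ w.2) (x, x) :=
    ContinuousAt.div (by fun_prop) (by fun_prop) hx
  have hev : ∀ᶠ w in 𝓝 x ×ˢ 𝓝 x, φ w.1 / φ w.2 ∈ Complex.slitPlane := by
    rw [← nhds_prod_eq]
    refine hcont.eventually_mem (Complex.isOpen_slitPlane.mem_nhds ?_)
    simp [hx]
  obtain ⟨V, hV, hVV⟩ := Filter.eventually_prod_self_iff'.1 hev
  have hsub := connectedComponentIn_subset V x
  exact ⟨connectedComponentIn V x, connectedComponentIn_mem_nhds hV,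
    isPreconnected_connectedComponentIn, fun y hy z hz ↦ hVV y (hsub hy) z (hsub hz)⟩

variable [MulAction Circle X]

theorem HasWeight.exists_smul_mem_closure_preimage_convexCone (hφ : HasWeight m φ) (hm : m ≠ 0)
    (D : ConvexCone ℝ ℂ) {w : ℂ} (hw : w ∈ D) (hw0 : w ≠ 0)
    (hopen : ∀ x, φ x = 0 → 𝓝 (φ x) ≤ (𝓝 x).map φ) (x : X) :
    ∃ a : Circle, a • x ∈ closure (φ ⁻¹' D) := by
  by_cases hx : φ x = 0
  · exact ⟨1, by simpa only [one_smul] using mem_closure_preimage_convexCone D hw hx (hopen x hx)⟩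
  · refine ⟨_, subset_closure (?_ : φ (Circle.exp (-(φ x / w).arg / m) • x) ∈ D)⟩
    rw [hφ.exp_smul_eq_norm_div_smul hm hw0]
    exact D.smul_mem (norm_pos_iff.2 (div_ne_zero hx hw0)) hw

variable [ContinuousSMul Circle X]

theorem HasWeight.subset_univ_smul_connectedComponentIn (hφ : HasWeight m φ) (hm : m ≠ 0)
    (hφc : Continuous φ) (D : ConvexCone ℝ ℂ) {U : Set X} (hU : IsPreconnected U) (hx : x ∈ U)
    (hxD : φ x ∈ D) (hslit : ∀ y ∈ U, φ y / φ x ∈ Complex.slitPlane) :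
    U ⊆ (univ : Set Circle) • connectedComponentIn (φ ⁻¹' D) x := by
  have hx0 : φ x ≠ 0 := by
    rintro h0
    simpa [h0] using hslit x hx
  set ρ : X → Circle := fun y ↦ Circle.exp (-(φ y / φ x).arg / m)
  have hρ : ContinuousOn (fun y ↦ ρ y • y) U := by
    refine ContinuousOn.smul (Circle.exp.continuous.comp_continuousOn ?_) continuousOn_id
    have hquot : ContinuousOn (fun y ↦ φ y / φ x) U := by fun_prop
    exact ((Complex.continuousOn_arg.comp hquot hslit).neg).div_const _
  have hρx : ρ x • x = x := by simp [ρ, hx0]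
  have himage : (fun y ↦ ρ y • y) '' U ⊆ connectedComponentIn (φ ⁻¹' D) x := by
    refine (hU.image _ hρ).subset_connectedComponentIn ⟨x, hx, hρx⟩ ?_
    rintro _ ⟨y, hy, rfl⟩
    rw [mem_preimage, hφ.exp_smul_eq_norm_div_smul hm hx0]
    exact D.smul_mem (norm_pos_iff.2 (Complex.slitPlane_ne_zero (hslit y hy))) hxD
  intro y hy
  exact ⟨(ρ y)⁻¹, mem_univ _, ρ y • y, himage ⟨y, hy, rfl⟩, inv_smul_smul _ y⟩

theorem HasWeight.isConnected_preimage_convexCone [PreconnectedSpace X] [LocallyConnectedSpace X]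
    (hφ : HasWeight m φ) (hm : m ≠ 0) (hφc : Continuous φ) (hφ0 : ∃ x, φ x = 0)
    (D : ConvexCone ℝ ℂ) {w : ℂ} (hw : w ∈ D) (hw0 : w ≠ 0)
    (hopen : ∀ x, φ x = 0 → 𝓝 (φ x) ≤ (𝓝 x).map φ)
    (hloc : ∀ x, φ x = 0 → ∃ U ∈ 𝓝 x, IsPreconnected (φ ⁻¹' D ∩ U)) :
    IsConnected (φ ⁻¹' D) := by
  refine isConnected_of_invariant_adherent (G := Circle) (Z := {x | φ x = 0})
    (fun a x ↦ (hφ.smul_eq_zero_iff a).2)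
    (fun x hx ↦ mem_closure_preimage_convexCone D hw hx (hopen x hx)) hloc
    (hφ.exists_smul_mem_closure_preimage_convexCone hm D hw hw0 hopen) (fun x hx ↦ ?_) hφ0
  obtain ⟨U, hU, hUconn, hslit⟩ := exists_isPreconnected_div_mem_slitPlane hφc hx
  exact ⟨U, hU, fun y hy ↦ hφ.subset_univ_smul_connectedComponentIn hm hφc D hUconn hy.2 hy.1
    fun z hz ↦ hslit z hz y hy.2⟩

end WeightedFunctions

section PrincipalBundle

variable {n : ℕ}
  {M : Type*} [TopologicalSpace M] [ChartedSpace (EuclideanSpace ℝ (Fin n)) M]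
  {X : Type*} [TopologicalSpace X] [ChartedSpace (EuclideanSpace ℝ (Fin (n + 1))) X]
  [MulAction Circle X] {pr : X → M}

theorem IsPrincipal.continuousSMul (h : IsPrincipal n pr) : ContinuousSMul Circle X :=
  ⟨h.smooth_action.continuous⟩

theorem IsPrincipal.isOpenMap (h : IsPrincipal n pr) : IsOpenMap pr := by
  refine IsOpenMap.of_nhds_le fun x ↦ ?_
  obtain ⟨e, hx, -⟩ := h.locally_trivial (pr x)
  exact (e.map_proj_nhds (e.mem_source.2 hx)).ge

theorem IsPrincipal.isConnected_fiber (h : IsPrincipal n pr) (z : M) :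
    IsConnected (pr ⁻¹' {z}) := by
  have := h.continuousSMul
  obtain ⟨x, rfl⟩ := h.surjective z
  have horbit : pr ⁻¹' {pr x} = range fun a : Circle ↦ a • x := by
    ext y
    refine ⟨fun hy ↦ h.exists_smul_eq (Eq.symm hy), ?_⟩
    rintro ⟨a, rfl⟩
    exact h.proj_smul a x
  rw [horbit]
  exact isConnected_range (by fun_prop)

theorem IsPrincipal.connectedSpace [ConnectedSpace M] (h : IsPrincipal n pr) :
    ConnectedSpace X := by
  have hquot := h.isOpenMap.isQuotientMap h.smooth_proj.continuous h.surjective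
  refine connectedSpace_iff_univ.2 ?_
  rw [← preimage_univ (f := pr)]
  exact hquot.isCoinducing.isConnected_preimage_of_isClosed h.isConnected_fiber isClosed_univ
    isConnected_univ

theorem exists_eq_zero_of_assocSection_eq {m : ℤ} {φ : X → ℂ} (h : IsPrincipal n pr) {z : M}
    (hz : assocSection h m φ z = zeroLineSection h m z) : ∃ x, φ x = 0 := by
  obtain ⟨a, -, ha⟩ := Quotient.exact hz
  exact ⟨_, (mul_eq_zero.1 ha).resolve_left (zpow_ne_zero m a.coe_ne_zero)⟩

end PrincipalBundle

section TwoComponents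

variable {X : Type*} [TopologicalSpace X]

theorem card_connectedComponents_of_isClopen {U : Set X} (hU : IsClopen U) (hconn : IsConnected U)
    (hconn' : IsConnected Uᶜ) : Nat.card (ConnectedComponents X) = 2 := by
  let V : Bool → Set X := fun b ↦ bif b then U else Uᶜ
  have hV : ∀ b, IsClopen (V b) := Bool.forall_bool.2 ⟨hU.compl, hU⟩
  have hVconn : ∀ b, IsConnected (V b) := Bool.forall_bool.2 ⟨hconn', hconn⟩
  have hdisj : Pairwise (Function.onFun Disjoint V) :=
    pairwise_disjoint_on_bool.2 disjoint_compl_right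
  have hunion : ⋃ b, V b = univ := union_eq_iUnion.symm.trans (union_compl_self U)
  simpa using Nat.card_congr
    (ConnectedComponents.equivOfIsClopenOfIsConnected hV hdisj hunion hVconn)

theorem card_connectedComponents_compl_zeros {f : X → ℝ} (hf : Continuous f)
    (hpos : IsConnected {x | 0 < f x}) (hneg : IsConnected {x | f x < 0}) :
    Nat.card (ConnectedComponents ↥{x | f x = 0}ᶜ) = 2 := by
  let Y := ↥{x | f x = 0}ᶜ
  have hcompl : {x : Y | 0 < f x}ᶜ = {x : Y | f x < 0} := by
    ext x
    exact not_lt.trans (le_iff_lt_or_eq.trans (or_iff_left x.2))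
  have hfY : Continuous fun x : Y ↦ f x := hf.comp continuous_subtype_val
  have hposY : IsOpen {x : Y | 0 < f x} := isOpen_lt continuous_const hfY
  have hnegY : IsOpen {x : Y | f x < 0} := isOpen_lt hfY continuous_const
  have hopen : IsOpenMap (Subtype.val : Y → X) :=
    (isOpen_ne_fun hf continuous_const).isOpenMap_subtype_val
  refine card_connectedComponents_of_isClopen (U := {x : Y | 0 < f x})
    ⟨isOpen_compl_iff.1 (hcompl ▸ hnegY), hposY⟩ ?_ (hcompl ▸ ?_)
  · refine hpos.preimage_of_isOpenMap Subtype.val_injective hopen ?_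
    exact fun x hx ↦ ⟨⟨x, LT.lt.ne' hx⟩, rfl⟩
  · refine hneg.preimage_of_isOpenMap Subtype.val_injective hopen ?_
    exact fun x hx ↦ ⟨⟨x, LT.lt.ne hx⟩, rfl⟩

end TwoComponents

theorem exists_isPreconnected_inter_of_convex {X E : Type*} [TopologicalSpace X]
    [AddCommGroup E] [Module ℝ E] [TopologicalSpace E] [IsTopologicalAddGroup E]
    [ContinuousSMul ℝ E] [LocallyConvexSpace ℝ E] (e : OpenPartialHomeomorph X E) {x : X}
    (hx : x ∈ e.source) {S : Set X} {T : Set E} (hT : Convex ℝ T)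
    (hST : ∀ y ∈ e.source, y ∈ S ↔ e y ∈ T) :
    ∃ U ∈ 𝓝 x, IsPreconnected (S ∩ U) := by
  obtain ⟨V, ⟨hVx, hVconv⟩, hV : V ⊆ e.target⟩ :=
    (LocallyConvexSpace.convex_basis (𝕜 := ℝ) (e x)).mem_iff.1
      (e.open_target.mem_nhds (e.map_source hx))
  refine ⟨e.source ∩ e ⁻¹' V, Filter.inter_mem (e.open_source.mem_nhds hx)
    (e.continuousAt hx hVx), ?_⟩
  have himage : S ∩ (e.source ∩ e ⁻¹' V) = e.symm '' (T ∩ V) := by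
    rw [e.symm_image_eq_source_inter_preimage (inter_subset_right.trans hV)]
    ext y
    exact ⟨fun ⟨hyS, hy, hyV⟩ ↦ ⟨hy, (hST y hy).1 hyS, hyV⟩,
      fun ⟨hy, hyT, hyV⟩ ↦ ⟨(hST y hy).2 hyT, hy, hyV⟩⟩
  rw [himage]
  exact (hT.inter hVconv).isPreconnected.image _
    (e.continuousOn_symm.mono (inter_subset_right.trans hV))

section Submersions

variable {E F : Type*} [NormedAddCommGroup E] [NormedSpace ℝ E] [NormedAddCommGroup F]
  [NormedSpace ℝ F] {X : Type*} [TopologicalSpace X] [ChartedSpace E X] {f : X → F} {x : X}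
  {k : WithTop ℕ∞}

theorem mfderiv_eq_fderiv_comp_chartAt_symm (hf : MDifferentiableAt 𝓘(ℝ, E) 𝓘(ℝ, F) f x) :
    mfderiv 𝓘(ℝ, E) 𝓘(ℝ, F) f x = fderiv ℝ (f ∘ (chartAt E x).symm) (chartAt E x x) := by
  rw [hf.mfderiv]
  simp only [mfld_simps, fderivWithin_univ]
  rfl

theorem contDiffOn_comp_chartAt_symm [IsManifold 𝓘(ℝ, E) k X]
    (hf : ContMDiff 𝓘(ℝ, E) 𝓘(ℝ, F) k f) (x : X) :
    ContDiffOn ℝ k (f ∘ (chartAt E x).symm) (chartAt E x).target :=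
  contMDiffOn_iff_contDiffOn.1 (hf.comp_contMDiffOn contMDiffOn_chart_symm)

theorem hasStrictFDerivAt_comp_chartAt_symm [IsManifold 𝓘(ℝ, E) k X]
    (hf : ContMDiff 𝓘(ℝ, E) 𝓘(ℝ, F) k f) (hk : k ≠ 0) (x : X) :
    HasStrictFDerivAt (f ∘ (chartAt E x).symm) (mfderiv 𝓘(ℝ, E) 𝓘(ℝ, F) f x : E →L[ℝ] F)
      (chartAt E x x) := by
  rw [mfderiv_eq_fderiv_comp_chartAt_symm ((hf x).mdifferentiableAt hk)]
  exact ((contDiffOn_comp_chartAt_symm hf x).contDiffAt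
    ((chartAt E x).open_target.mem_nhds (mem_chart_target E x))).hasStrictFDerivAt hk

theorem nhds_le_map_of_surjective_mfderiv [CompleteSpace E] [CompleteSpace F]
    [IsManifold 𝓘(ℝ, E) k X] (hf : ContMDiff 𝓘(ℝ, E) 𝓘(ℝ, F) k f) (hk : k ≠ 0)
    (hx : Function.Surjective (mfderiv 𝓘(ℝ, E) 𝓘(ℝ, F) f x)) : 𝓝 (f x) ≤ (𝓝 x).map f := by
  have hmap := (hasStrictFDerivAt_comp_chartAt_symm hf hk x).map_nhds_eq_of_surj
    (LinearMap.range_eq_top.2 hx)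
  rw [← Filter.map_map, (chartAt E x).symm_map_nhds_eq (mem_chart_source E x), Function.comp_apply,
    (chartAt E x).left_inv (mem_chart_source E x)] at hmap
  exact hmap.ge

theorem exists_isPreconnected_preimage_inter [CompleteSpace E] [FiniteDimensional ℝ F]
    [IsManifold 𝓘(ℝ, E) k X] (hf : ContMDiff 𝓘(ℝ, E) 𝓘(ℝ, F) k f) (hk : k ≠ 0)
    (hx : Function.Surjective (mfderiv 𝓘(ℝ, E) 𝓘(ℝ, F) f x)) {D : Set F} (hD : Convex ℝ D) :
    ∃ U ∈ 𝓝 x, IsPreconnected (f ⁻¹' D ∩ U) := by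
  have : CompleteSpace F := FiniteDimensional.complete ℝ F
  have hstrict := hasStrictFDerivAt_comp_chartAt_symm hf hk x
  let Ψ := hstrict.implicitToOpenPartialHomeomorph _ _ (LinearMap.range_eq_top.2 hx)
  refine exists_isPreconnected_inter_of_convex ((chartAt E x).trans Ψ) (T := Prod.fst ⁻¹' D)
    ?_ (hD.is_linear_preimage ⟨fun _ _ ↦ rfl, fun _ _ ↦ rfl⟩) fun y hy ↦ ?_
  · rw [OpenPartialHomeomorph.trans_source]
    exact ⟨mem_chart_source E x, hstrict.mem_implicitToOpenPartialHomeomorph_source _⟩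
  · rw [OpenPartialHomeomorph.trans_source] at hy
    have hfst : (Ψ (chartAt E x y)).1 = f y := by
      rw [hstrict.implicitToOpenPartialHomeomorph_fst, Function.comp_apply,
        (chartAt E x).left_inv hy.1]
    rw [mem_preimage, mem_preimage, OpenPartialHomeomorph.trans_apply, hfst]

end Submersions

section Straightening

theorem exists_openPartialHomeomorph_contDiffOn_symm {𝕂 E F : Type*} [RCLike 𝕂]
    [NormedAddCommGroup E] [NormedSpace 𝕂 E] [CompleteSpace E] [NormedAddCommGroup F]
    [NormedSpace 𝕂 F] {f : E → F} {s : Set E} {a : E} {k : WithTop ℕ∞} (hs : IsOpen s)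
    (hf : ContDiffOn 𝕂 k f s) (hk : k ≠ 0) (ha : a ∈ s) {f' : E ≃L[𝕂] F}
    (hf' : HasFDerivAt f (f' : E →L[𝕂] F) a) :
    ∃ Ψ : OpenPartialHomeomorph E F, a ∈ Ψ.source ∧ Ψ.source ⊆ s ∧ (Ψ : E → F) = f ∧
      ContDiffOn 𝕂 k Ψ.symm Ψ.target := by
  have hfa : ContDiffAt 𝕂 k f a := hf.contDiffAt (hs.mem_nhds ha)
  let t : Set E := s ∩ fderiv 𝕂 f ⁻¹' range ((↑) : (E ≃L[𝕂] F) → E →L[𝕂] F)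
  have hfderiv : ContinuousOn (fderiv 𝕂 f) s :=
    hf.continuousOn_fderiv_of_isOpen hs (ENat.one_le_iff_ne_zero_withTop.2 hk)
  have ht : IsOpen t := hfderiv.isOpen_inter_preimage hs ContinuousLinearEquiv.isOpen
  let Ψ := (hfa.toOpenPartialHomeomorph f hf' hk).restrOpen t ht
  have hΨt : Ψ.source ⊆ t := inter_subset_right
  refine ⟨Ψ, ⟨hfa.mem_toOpenPartialHomeomorph_source hf' hk, ha, f', hf'.fderiv.symm⟩,
    hΨt.trans inter_subset_left, rfl, fun w hw ↦ ?_⟩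
  obtain ⟨hws, A, hA⟩ := hΨt (Ψ.map_target hw)
  have hfw : ContDiffAt 𝕂 k f (Ψ.symm w) := hf.contDiffAt (hs.mem_nhds hws)
  have hfw' : HasFDerivAt f (A : E →L[𝕂] F) (Ψ.symm w) :=
    hA ▸ (hfw.differentiableAt hk).hasFDerivAt
  exact (Ψ.contDiffAt_symm hw hfw' hfw).contDiffWithinAt

variable {E : Type*} [NormedAddCommGroup E] [NormedSpace ℝ E] [FiniteDimensional ℝ E]

theorem exists_openPartialHomeomorph_apply_eq {f : E → ℝ} {s : Set E} {a : E} {k : WithTop ℕ∞}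
    (hs : IsOpen s) (hf : ContDiffOn ℝ k f s) (hk : k ≠ 0) (ha : a ∈ s)
    (hfa : fderiv ℝ f a ≠ 0) {l : E →L[ℝ] ℝ} (hl : l ≠ 0) :
    ∃ Ψ : OpenPartialHomeomorph E E, a ∈ Ψ.source ∧ (∀ y, l (Ψ y) = f y) ∧
      ContDiffOn ℝ k Ψ Ψ.source ∧ ContDiffOn ℝ k Ψ.symm Ψ.target := by
  have : CompleteSpace E := FiniteDimensional.complete ℝ E
  obtain ⟨u, hlu, hfu⟩ : ∃ u, l u = 1 ∧ fderiv ℝ f a u ≠ 0 := by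
    obtain ⟨v, hv⟩ := Module.Dual.exists_forall_ne_zero_of_forall_exists
      ![l.toLinearMap, (fderiv ℝ f a).toLinearMap]
      (Fin.forall_fin_two.2 ⟨DFunLike.ne_iff.1 hl, DFunLike.ne_iff.1 hfa⟩)
    obtain ⟨hlv, hfv⟩ : l v ≠ 0 ∧ fderiv ℝ f a v ≠ 0 := Fin.forall_fin_two.1 hv
    exact ⟨(l v)⁻¹ • v, by simp [hlv], by simp [hlv, hfv]⟩
  -- As `l u = 1`, moving `y` by `f y - l y` along `u` changes the value of `l` from `l y` to `f y`;
  -- the derivative at `a` is invertible because `fderiv ℝ f a u ≠ 0`.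
  let g : E → E := fun y ↦ y + (f y - l y) • u
  have hg : ContDiffOn ℝ k g s :=
    contDiffOn_id.add ((hf.sub l.contDiff.contDiffOn).smul contDiffOn_const)
  have hunit : IsUnit (1 + (fderiv ℝ f a - l : E →L[ℝ] ℝ).toLinearMap u) := by
    simpa [hlu] using hfu
  let A : E ≃L[ℝ] E := (LinearEquiv.dilatransvection hunit).toContinuousLinearEquiv
  have hgA : HasFDerivAt g (A : E →L[ℝ] E) a := by
    have hfd : HasFDerivAt f (fderiv ℝ f a) a :=
      ((hf.contDiffAt (hs.mem_nhds ha)).differentiableAt hk).hasFDerivAt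
    exact (hasFDerivAt_id a).add ((hfd.sub l.hasFDerivAt).smul_const u)
  obtain ⟨Ψ, haΨ, hΨs, hΨg, hΨsymm⟩ :=
    exists_openPartialHomeomorph_contDiffOn_symm hs hg hk ha hgA
  refine ⟨Ψ, haΨ, fun y ↦ ?_, hΨg ▸ hg.mono hΨs, hΨsymm⟩
  simp [hΨg, g, hlu]

theorem exists_mem_maximalAtlas_apply_eq {X : Type*} [TopologicalSpace X] [ChartedSpace E X]
    {k : WithTop ℕ∞} [IsManifold 𝓘(ℝ, E) k X] {f : X → ℝ} (hf : ContMDiff 𝓘(ℝ, E) 𝓘(ℝ, ℝ) k f)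
    (hk : k ≠ 0) {x : X} (hx : mfderiv 𝓘(ℝ, E) 𝓘(ℝ, ℝ) f x ≠ 0) {l : E →L[ℝ] ℝ} (hl : l ≠ 0) :
    ∃ e ∈ IsManifold.maximalAtlas 𝓘(ℝ, E) k X, x ∈ e.source ∧ ∀ y ∈ e.source, l (e y) = f y := by
  set c := chartAt E x
  have hxc : x ∈ c.source := mem_chart_source E x
  have hc : c ∈ IsManifold.maximalAtlas 𝓘(ℝ, E) k X := IsManifold.chart_mem_maximalAtlas x
  rw [mfderiv_eq_fderiv_comp_chartAt_symm ((hf x).mdifferentiableAt hk)] at hx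
  obtain ⟨Ψ, hxΨ, hΨf, hΨ, hΨsymm⟩ := exists_openPartialHomeomorph_apply_eq c.open_target
    (contDiffOn_comp_chartAt_symm hf x) hk (c.map_source hxc) hx hl
  refine ⟨c.trans Ψ, (c.trans Ψ).mem_maximalAtlas_of_contMDiffOn ?_ ?_, ?_, fun y hy ↦ ?_⟩
  · exact hΨ.contMDiffOn.comp ((contMDiffOn_of_mem_maximalAtlas hc).mono (by simp)) (by simp)
  · exact (contMDiffOn_symm_of_mem_maximalAtlas hc).comp (hΨsymm.contMDiffOn.mono (by simp))
      (by simp)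
  · rw [OpenPartialHomeomorph.trans_source]
    exact ⟨hxc, hxΨ⟩
  · rw [OpenPartialHomeomorph.trans_source] at hy
    rw [OpenPartialHomeomorph.trans_apply, hΨf, Function.comp_apply, c.left_inv hy.1]

end Straightening

theorem isEmbeddedHypersurface_zeros {n : ℕ} {X : Type*} [TopologicalSpace X]
    [ChartedSpace (EuclideanSpace ℝ (Fin (n + 1))) X] [IsManifold (𝓡 (n + 1)) ∞ X]
    {f : X → ℝ} (hf : ContMDiff (𝓡 (n + 1)) 𝓘(ℝ, ℝ) ∞ f)
    (hreg : ∀ x, f x = 0 → mfderiv (𝓡 (n + 1)) 𝓘(ℝ, ℝ) f x ≠ 0) :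
    IsEmbeddedHypersurface n {x | f x = 0} := by
  let l : EuclideanSpace ℝ (Fin (n + 1)) →L[ℝ] ℝ := EuclideanSpace.proj (Fin.last n)
  have hl : l ≠ 0 :=
    DFunLike.ne_iff.2 ⟨EuclideanSpace.single (Fin.last n) 1, by simp [l]⟩
  intro x hx
  obtain ⟨e, he, hxe, hef⟩ := exists_mem_maximalAtlas_apply_eq hf (by simp) (hreg x hx) hl
  refine ⟨e, he, hxe, fun p hp ↦ ?_⟩
  rw [mem_ofPred_eq, ← hef p hp]
  rfl

section Regularity

variable {n : ℕ}
  {X : Type*} [TopologicalSpace X] [ChartedSpace (EuclideanSpace ℝ (Fin (n + 1))) X]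
  {m : ℤ} {φ : X → ℂ}

theorem re_mfderiv_apply {x : X} (hφx : MDifferentiableAt (𝓡 (n + 1)) 𝓘(ℝ, ℂ) φ x)
    (v : TangentSpace (𝓡 (n + 1)) x) :
    mfderiv (𝓡 (n + 1)) 𝓘(ℝ, ℝ) (fun y ↦ (φ y).re) x v =
      (mfderiv (𝓡 (n + 1)) 𝓘(ℝ, ℂ) φ x v : ℂ).re := by
  have hchain := mfderiv_comp_apply (I := 𝓡 (n + 1)) (I' := 𝓘(ℝ, ℂ)) (I'' := 𝓘(ℝ, ℝ))
    (g := Complex.reCLM) (f := φ) x Complex.reCLM.differentiableAt.mdifferentiableAt hφx v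
  rw [mfderiv_eq_fderiv, ContinuousLinearMap.fderiv] at hchain
  exact hchain

variable {M : Type*} [TopologicalSpace M] [ChartedSpace (EuclideanSpace ℝ (Fin n)) M]
  [MulAction Circle X] {pr : X → M}

theorem HasWeight.mfderiv_apply_generator (hφ : HasWeight m φ) (h : IsPrincipal n pr) {x : X}
    (hφx : MDifferentiableAt (𝓡 (n + 1)) 𝓘(ℝ, ℂ) φ x) :
    (mfderiv (𝓡 (n + 1)) 𝓘(ℝ, ℂ) φ x (generator n x) : ℂ) = (m : ℂ) * Complex.I * φ x := by
  have horbit : ContMDiff 𝓘(ℝ, ℝ) (𝓡 (n + 1)) ∞ fun θ : ℝ ↦ Circle.exp θ • x :=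
    h.smooth_action.comp (contMDiff_circleExp.prodMk contMDiff_const)
  have hchain := mfderiv_comp_apply_of_eq (I := 𝓘(ℝ, ℝ)) (I' := 𝓡 (n + 1)) (I'' := 𝓘(ℝ, ℂ))
    (g := φ) (f := fun θ : ℝ ↦ Circle.exp θ • x) (x := 0) (y := x) hφx
    ((horbit 0).mdifferentiableAt (by simp)) (by simp) (1 : ℝ)
  rw [mfderiv_eq_fderiv] at hchain
  exact hchain.symm.trans (hφ.hasDerivAt_exp_smul x).deriv

theorem HasWeight.mfderiv_re_ne_zero (hφ : HasWeight m φ) (hm : m ≠ 0) (h : IsPrincipal n pr)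
    (hreg : ZeroIsRegularValue (n + 1) φ) {x : X}
    (hφx : MDifferentiableAt (𝓡 (n + 1)) 𝓘(ℝ, ℂ) φ x) (hx : (φ x).re = 0) :
    mfderiv (𝓡 (n + 1)) 𝓘(ℝ, ℝ) (fun y ↦ (φ y).re) x ≠ 0 := by
  suffices ∃ v : TangentSpace (𝓡 (n + 1)) x,
      (mfderiv (𝓡 (n + 1)) 𝓘(ℝ, ℂ) φ x v : ℂ).re ≠ 0 by
    obtain ⟨v, hv⟩ := this
    exact DFunLike.ne_iff.2 ⟨v, (re_mfderiv_apply hφx v).trans_ne hv⟩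
  by_cases hx0 : φ x = 0
  · obtain ⟨v, hv⟩ := hreg x hx0 (1 : ℂ)
    exact ⟨v, hv ▸ one_ne_zero⟩
  · refine ⟨generator n x, fun h0 ↦ hx0 (Complex.ext hx ?_)⟩
    rw [hφ.mfderiv_apply_generator h hφx] at h0
    simpa [hm, hx] using h0

theorem HasWeight.isEmbeddedHypersurface_nodalSet [IsManifold (𝓡 (n + 1)) ∞ X]
    (hφ : HasWeight m φ) (hm : m ≠ 0) (h : IsPrincipal n pr)
    (hφs : ContMDiff (𝓡 (n + 1)) 𝓘(ℝ, ℂ) ∞ φ) (hreg : ZeroIsRegularValue (n + 1) φ) :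
    IsEmbeddedHypersurface n (nodalSet φ) :=
  isEmbeddedHypersurface_zeros (Complex.reCLM.contDiff.contMDiff.comp hφs) fun x hx ↦
    hφ.mfderiv_re_ne_zero hm h hreg ((hφs x).mdifferentiableAt (by simp)) hx

end Regularity

theorem HasWeight.isConnected_preimage_of_isPrincipal {n : ℕ}
    {M : Type*} [TopologicalSpace M] [ConnectedSpace M] [ChartedSpace (EuclideanSpace ℝ (Fin n)) M]
    {X : Type*} [TopologicalSpace X] [ChartedSpace (EuclideanSpace ℝ (Fin (n + 1))) X]
    [IsManifold (𝓡 (n + 1)) ∞ X] [MulAction Circle X] {pr : X → M} {m : ℤ} {φ : X → ℂ}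
    (hφ : HasWeight m φ) (hm : m ≠ 0) (h : IsPrincipal n pr)
    (hφs : ContMDiff (𝓡 (n + 1)) 𝓘(ℝ, ℂ) ∞ φ) (hreg : ZeroIsRegularValue (n + 1) φ)
    (hzero : ∃ x, φ x = 0) (D : ConvexCone ℝ ℂ) {w : ℂ} (hw : w ∈ D) (hw0 : w ≠ 0) :
    IsConnected (φ ⁻¹' D) := by
  have := h.continuousSMul
  have := h.connectedSpace
  have := ChartedSpace.locallyConnectedSpace (EuclideanSpace ℝ (Fin (n + 1))) X
  exact hφ.isConnected_preimage_convexCone hm hφs.continuous hzero D hw hw0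
    (fun x hx ↦ nhds_le_map_of_surjective_mfderiv hφs (by simp) (hreg x hx))
    fun x hx ↦ exists_isPreconnected_preimage_inter hφs (by simp) (hreg x hx) D.convex

end CircleBundle

theorem mainTheorem3_general {n : ℕ}
    {M : Type*} [TopologicalSpace M] [ConnectedSpace M] [ChartedSpace (EuclideanSpace ℝ (Fin n)) M]
    {X : Type*} [TopologicalSpace X] [ChartedSpace (EuclideanSpace ℝ (Fin (n + 1))) X]
    [IsManifold (𝓡 (n + 1)) ∞ X] [MulAction Circle X] {pr : X → M} (hpr : IsPrincipal n pr)
    {m : ℤ} (hm : m ≠ 0) {φ : X → ℂ} (hφs : ContMDiff (𝓡 (n + 1)) 𝓘(ℝ, ℂ) ∞ φ)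
    (hφ : HasWeight m φ) (hreg : ZeroIsRegularValue (n + 1) φ)
    (hzero : ∃ z₀ : M, assocSection hpr m φ z₀ = zeroLineSection hpr m z₀) :
    IsEmbeddedHypersurface n (nodalSet φ) ∧
      IsConnected (nodalSet φ) ∧
      Nat.card (ConnectedComponents ↥(nodalSet φ)ᶜ) = 2 := by
  obtain ⟨z₀, hz₀⟩ := hzero
  have hconn (D : ConvexCone ℝ ℂ) {w : ℂ} (hw : w ∈ D) (hw0 : w ≠ 0) : IsConnected (φ ⁻¹' D) :=
    hφ.isConnected_preimage_of_isPrincipal hm hpr hφs hreg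
      (exists_eq_zero_of_assocSection_eq hpr hz₀) D hw hw0
  let pos := ConvexCone.strictlyPositive ℝ ℝ
  refine ⟨hφ.isEmbeddedHypersurface_nodalSet hm hpr hφs hreg, ?_, ?_⟩
  · exact hconn ((0 : ConvexCone ℝ ℝ).comap Complex.reLm) (w := Complex.I) Complex.I_re
      Complex.I_ne_zero
  · have hre : Continuous fun x ↦ (φ x).re := Complex.continuous_re.comp hφs.continuous
    have hpos : IsConnected {x | 0 < (φ x).re} :=
      hconn (pos.comap Complex.reLm) (w := 1) (by simp [pos]) one_ne_zero
    have hneg : IsConnected {x | 0 < -(φ x).re} :=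
      hconn (pos.comap (-Complex.reLm)) (w := -1) (by simp [pos]) (by simp)
    exact card_connectedComponents_compl_zeros hre hpos (by simpa only [neg_pos] using hneg)

theorem mainTheorem3 {n : ℕ}
    {M : Type*} [TopologicalSpace M] [T2Space M] [CompactSpace M] [ConnectedSpace M]
    [ChartedSpace (EuclideanSpace ℝ (Fin n)) M] [IsManifold (𝓡 n) ∞ M]
    {X : Type*} [TopologicalSpace X] [T2Space X]
    [ChartedSpace (EuclideanSpace ℝ (Fin (n + 1))) X] [IsManifold (𝓡 (n + 1)) ∞ X]
    [MulAction Circle X] (pr : X → M) (hpr : IsPrincipal n pr)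
    (g : RMetric n M)
    (α : ∀ x : X, TangentSpace (𝓡 (n + 1)) x →L[ℝ] ℝ) (hα : IsConnectionForm α)
    (N : ℝ) (hN : 0 < N)
    (G : RMetric (n + 1) X) (hG : IsBundleMetric pr N α g G)
    (m : ℤ) (hm : m ≠ 0)
    (φ : X → ℂ) (hφ : IsEquivariantEigenfunction G m φ)
    (hreg : ZeroIsRegularValue (n + 1) φ)
    (hzero : ∃ z₀ : M, assocSection hpr m φ z₀ = zeroLineSection hpr m z₀) :
    IsEmbeddedHypersurface n (nodalSet φ) ∧
      IsConnected (nodalSet φ) ∧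
      Nat.card (ConnectedComponents ↥(nodalSet φ)ᶜ) = 2 := by
  exact mainTheorem3_general hpr hm hφ.smooth hφ.equivariant hreg hzero
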